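/- Let $n$ be a natural number and let $\mu$ be a Borel probability measure on the space $\mathbb{R}^{n\times n}$ of real $n\times n$ matrices whose support $\mathcal M=\operatorname{supp}\mu$ is bounded. Assume: (A2) $\mathcal M$ leaves a proper cone invariant: there is a set $K\subset\mathbb{R}^n$ that is closed under multiplication by nonnegative numbers, closed, convex, has nonempty interior, satisfies $K\cap(-K)=\{0\}$, and is such that $AK\subset K$ for every $A\in\mathcal M$; (A3) the singular part $\mu_s$ of $\mu$ (in the Lebesgue decomposition of $\mu$ with respect to Lebesgue measure on $\mathbb{R}^{n\times n}$) is either $0$ or of the form $\mu_s=c_1\delta_{M_1}+\dots+c_N\delta_{M_N}$ with $c_1,\dots,c_N>0$ and $M_1,\dots,M_N\in\mathbb{R}^{n\times n}$, where $\delta_M$ is the Dirac measure at $M$. Let $\|\cdot\|$ denote the maximal singular value of a matrix and $\rho(\cdot)$ the spectral radius of a square matrix. Let $$\hat\rho(\mathcal M)=\limsup_{k\to\infty}\ \sup_{A_1,\dots,A_k\in\mathcal M}\|A_k\cdots A_1\|^{1/k}$$ be the joint spectral radius of $\mathcal M$ and, for every integer $p\ge 1$, let $$\rho_{p,\mu}=\lim_{k\to\infty}\bigl(E[\|A_k\cdots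 A_1\|^p]\bigr)^{1/(pk)}$$ be the $L^p$-norm joint spectral radius of $\mu$, where $A_1,A_2,\dots$ are independent random matrices with distribution $\mu$. Let $A$ be a random matrix with distribution $\mu$, and let $A^{\otimes p}$ be its $p$-th Kronecker power, an $n^p\times n^p$ matrix. Then $\hat\rho(\mathcal M)$ is finite, the limit that defines $\rho_{p,\mu}$ exists and is finite and $A^{\otimes p}$ is integrable for every $p\geq 1$, and $$\hat\rho(\mathcal M)=\lim_{p\to\infty}\rho_{p,\mu}=\lim_{p\to\infty}\rho\bigl(E[A^{\otimes p}]\bigr)^{1/p},$$ where both limits over positive integers $p$ exist. -/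

import Mathlib

open MeasureTheory Filter Topology
open scoped ENNReal Kronecker Matrix Matrix.Norms.L2Operator

/-- Real `n × n` matrices. The norm `‖A‖` in force on them is the operator norm for the Euclidean
norm, that is, the maximal singular value. -/
abbrev RMat (n : ℕ) : Type := Matrix (Fin n) (Fin n) ℝ

/-- The product `σ`-algebra on `ℝ^(n × n)`. -/
instance RMat.instMeasurableSpace (n : ℕ) : MeasurableSpace (RMat n) :=
  inferInstanceAs (MeasurableSpace (Fin n → Fin n → ℝ))

/-- The product `σ`-algebra is the Borel `σ`-algebra. -/
instance RMat.instBorelSpace (n : ℕ) : BorelSpace (RMat n) :=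
  inferInstanceAs (BorelSpace (Fin n → Fin n → ℝ))

/-- Lebesgue measure on `ℝ^(n × n)`. -/
noncomputable def lebesgueRMat (n : ℕ) : Measure (RMat n) :=
  (volume : Measure (Fin n → Fin n → ℝ))

/-- A proper cone in `ℝⁿ`: a cone (closed under multiplication by nonnegative numbers) that is
closed, convex, solid and pointed. -/
structure IsSolidPointedCone {n : ℕ} (K : Set (Fin n → ℝ)) : Prop where
  smul_mem : ∀ c : ℝ, 0 ≤ c → ∀ x ∈ K, c • x ∈ K
  isClosed : IsClosed K
  convex : Convex ℝ K
  solid : (interior K).Nonempty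
  pointed : ∀ x, x ∈ K → -x ∈ K → x = 0

/-- The set `M` of matrices leaves the set `K` invariant. -/
def LeavesInvariant {n : ℕ} (M : Set (RMat n)) (K : Set (Fin n → ℝ)) : Prop :=
  ∀ A ∈ M, ∀ x ∈ K, A *ᵥ x ∈ K

/-- `M` leaves some proper cone of `ℝⁿ` invariant. -/
def LeavesProperConeInvariant {n : ℕ} (M : Set (RMat n)) : Prop :=
  ∃ K : Set (Fin n → ℝ), IsSolidPointedCone K ∧ LeavesInvariant M K

/-- The singular part of `μ` (in its Lebesgue decomposition with respect to Lebesgue measure) is a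
combination, with positive coefficients, of finitely many Dirac measures; `N = 0` is the case of
a vanishing singular part. -/
def SingularPartIsFiniteDiracSum {n : ℕ} (μ : Measure (RMat n)) : Prop :=
  ∃ (N : ℕ) (c : Fin N → ℝ) (M : Fin N → RMat n), (∀ i, 0 < c i) ∧
    μ.singularPart (lebesgueRMat n) = ∑ i, ENNReal.ofReal (c i) • Measure.dirac (M i)

/-- The product `A (k-1) * ⋯ * A 1 * A 0`. -/
def backwardProd {n k : ℕ} (A : Fin k → RMat n) : RMat n :=
  (List.ofFn fun i : Fin k => A i.rev).prod

/-- The joint spectral radius `limsup_{k → ∞} sup_{A_1, …, A_k ∈ M} ‖A_k ⋯ A_1‖^(1/k)`. -/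
noncomputable def jointSpectralRadius {n : ℕ} (M : Set (RMat n)) : ℝ≥0∞ :=
  limsup (fun k : ℕ => ⨆ (A : Fin k → RMat n) (_ : ∀ i, A i ∈ M),
    ‖backwardProd A‖ₑ ^ (1 / (k : ℝ))) atTop

/-- `E[‖A_k ⋯ A_1‖^p]^(1/(pk))`, for independent `A_1, …, A_k` following `μ`. -/
noncomputable def pMean {n : ℕ} (μ : Measure (RMat n)) [SigmaFinite μ] (p k : ℕ) : ℝ≥0∞ :=
  (∫⁻ A : Fin k → RMat n, ‖backwardProd A‖ₑ ^ p ∂(Measure.pi fun _ => μ)) ^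
    (1 / ((p : ℝ) * (k : ℝ)))

/-- The `p`-radius `lim_{k → ∞} E[‖A_k ⋯ A_1‖^p]^(1/(pk))`. -/
noncomputable def pRadius {n : ℕ} (μ : Measure (RMat n)) [SigmaFinite μ] (p : ℕ) : ℝ≥0∞ :=
  limUnder atTop (pMean μ p)

/-- The row-major numbering `(i, j) ↦ n * i + j` of the index pairs of a Kronecker product of an
`n^p × n^p` matrix with an `n × n` matrix. -/
def kroneckerIdx (n p : ℕ) : Fin (n ^ p) × Fin n ≃ Fin (n ^ (p + 1)) :=
  finProdFinEquiv.trans (finCongr (pow_succ n p).symm)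

/-- The Kronecker power `A^{⊗p} = A^{⊗(p-1)} ⊗ A`, as an `n^p × n^p` matrix (`A^{⊗0}` is the
`1 × 1` identity matrix, so that `A^{⊗1} = A`). -/
def kroneckerPow {n : ℕ} (A : RMat n) : (p : ℕ) → RMat (n ^ p)
  | 0 => 1
  | p + 1 =>
    Matrix.reindex (kroneckerIdx n p) (kroneckerIdx n p) (kroneckerPow A p ⊗ₖ A)

/-- The (entrywise) expected value `E[A^{⊗p}]`, for `A` following `μ`. -/
noncomputable def expKroneckerPow {n : ℕ} (μ : Measure (RMat n)) (p : ℕ) : RMat (n ^ p) :=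
  Matrix.of fun i j => ∫ A, kroneckerPow A p i j ∂μ

/-- The spectral radius of a real matrix: the maximal modulus of its complex eigenvalues. -/
noncomputable def realSpectralRadius {m : ℕ} (B : RMat m) : ℝ≥0∞ :=
  spectralRadius ℂ (B.map Complex.ofReal)

/-! Choose `x` interior to the cone `K` and `φ` with `c * ‖y‖ ≤ φ ⬝ᵥ y` on `K`. For `K`-preserving
`B` the norm is at most a constant times `φ ⬝ᵥ B *ᵥ x` (`exists_norm_le_of_mem_coneMaps`), and the
`p`-th power of that number is linear in `B^{⊗p}`. Kronecker powers are multiplicative, so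
independence gives `E[(A_k ⋯ A_1)^{⊗p}] = E[A^{⊗p}]^k`. Hence `E‖A_k ⋯ A_1‖^p` and `‖E[A^{⊗p}]^k‖`
agree up to factors independent of `k`, and Gelfand's formula yields the `p`-radius
(`tendsto_pMean_of_leavesProperConeInvariant`). This needs only the cone and integrability.

The `p`-radius is at most the joint spectral radius, since almost every product has its factors in
the support. The converse needs a bound uniform in `k`. Order matrices by the cone `coneMaps K`, and
call `C` charged if a random matrix dominates `s • C` with positive probability for every `s < 1`.
If `C_1, …, C_k` are charged and `C_k ⋯ C_1 x ≥ l x`, repeating this block bounds `ρ(E[A^{⊗p}])^k`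
below by `(q s^p)^k l^p`, where `q` is the least of the `k` probabilities. Taking `p`-th roots, then
`p → ∞` and `s → 1`, removes `q` and `s`: `l ≤ L^k`, with `L` the lower limit of the `p`-radii
(`ofReal_le_liminf_pow`). To get such an `l` from any product `B`, append a charged `P` interior to
`coneMaps K`: it dominates a multiple of `x φᵀ`, so `P B x ≥ δ (φ ⬝ B x) x`, and `‖B‖` is at most a
constant times `L^(k+1)`.

The assumption on the singular part supplies the charged matrices (`support_dichotomy`). The
frontier of the convex set `coneMaps K` is Lebesgue-null, so the absolutely continuous part lives on
its interior, where support points are charged; atoms are charged too. If that part vanishes there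
may be no interior `P`, but the support is then a finite set of atoms and single sequences have
enough mass. -/

/-! ### Positive functionals on a proper cone -/

namespace IsSolidPointedCone

variable {n : ℕ} {K : Set (Fin n → ℝ)}

lemma zero_mem (hK : IsSolidPointedCone K) : (0 : Fin n → ℝ) ∈ K := by
  obtain ⟨x, hx⟩ := hK.solid
  simpa using hK.smul_mem 0 le_rfl x (interior_subset hx)

/-- A nonzero vector of a solid pointed cone is positive for some functional that is nonnegative
on the cone. -/
lemma exists_dual_pos (hK : IsSolidPointedCone K) {x : Fin n → ℝ} (hx : x ∈ K) (hx0 : x ≠ 0) :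
    ∃ f : (Fin n → ℝ) →L[ℝ] ℝ, (∀ y ∈ K, 0 ≤ f y) ∧ 0 < f x := by
  have hnx : -x ∉ K := fun h => hx0 (hK.pointed x hx h)
  obtain ⟨f, u, hfu, hf⟩ := geometric_hahn_banach_point_closed hK.convex hK.isClosed hnx
  have hu : u < 0 := by simpa using hf 0 hK.zero_mem
  refine ⟨f, fun y hy => ?_, ?_⟩
  · by_contra! hneg
    -- The factor moves `y` along its ray to where `f` equals `u`, against the strict separation.
    have := hf _ (hK.smul_mem (u / f y) (div_nonneg_of_nonpos hu.le hneg.le) y hy)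
    rw [map_smul, smul_eq_mul, div_mul_cancel₀ _ hneg.ne] at this
    exact lt_irrefl _ this
  · rw [map_neg] at hfu
    linarith

/-- The dual cone of a solid pointed cone has an interior point. -/
lemma exists_strictlyPositive (hK : IsSolidPointedCone K) :
    ∃ φ : Fin n → ℝ, ∃ c : ℝ, 0 < c ∧ ∀ x ∈ K, c * ‖x‖ ≤ φ ⬝ᵥ x := by
  set S : Set (Fin n → ℝ) := K ∩ Metric.sphere 0 1 with hS
  have hSc : IsCompact S := (isCompact_sphere 0 1).inter_left hK.isClosed
  have hS0 : ∀ x ∈ S, x ≠ 0 := by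
    rintro x ⟨-, hx⟩ rfl
    simp at hx
  choose! f hf hfpos using fun (x : Fin n → ℝ) (hx : x ∈ S) => hK.exists_dual_pos hx.1 (hS0 x hx)
  -- By compactness finitely many functionals suffice: their sum is positive on the whole unit slice
  -- of the cone.
  obtain ⟨t, htS, ht⟩ := hSc.elim_nhds_subcover (fun x => {y | 0 < f x y}) fun x hx =>
    (isOpen_lt continuous_const (f x).continuous).mem_nhds (hfpos x hx)
  set g : (Fin n → ℝ) →L[ℝ] ℝ := ∑ x ∈ t, f x with hg
  have hgpos : ∀ y ∈ S, 0 < g y := by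
    intro y hy
    obtain ⟨x, hxt, hxy⟩ := Set.mem_iUnion₂.1 (ht hy)
    rw [hg, sum_apply]
    exact Finset.sum_pos' (fun i hi => hf i (htS i hi) y hy.1) ⟨x, hxt, hxy⟩
  obtain ⟨c, hc, hcg⟩ := hSc.exists_forall_le' g.continuous.continuousOn hgpos
  refine ⟨fun i => g (Pi.single i 1), c, hc, fun x hx => ?_⟩
  have hgx : (fun i => g (Pi.single i 1)) ⬝ᵥ x = g x := by
    conv_rhs => rw [← ContinuousLinearMap.coe_coe, LinearMap.pi_apply_eq_sum_univ]
    simp only [dotProduct, smul_eq_mul, ContinuousLinearMap.coe_coe]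
    refine Finset.sum_congr rfl fun i _ => ?_
    rw [mul_comm]
    congr 2
    ext j
    simp [Pi.single_apply, eq_comm]
  rw [hgx]
  rcases eq_or_ne x 0 with rfl | hx0
  · simp
  have hpos : 0 < ‖x‖ := norm_pos_iff.2 hx0
  have hmem : ‖x‖⁻¹ • x ∈ S :=
    ⟨hK.smul_mem _ (inv_nonneg.2 hpos.le) x hx, by simp [norm_smul, hpos.ne']⟩
  have := hcg _ hmem
  rw [map_smul, smul_eq_mul] at this
  calc c * ‖x‖ ≤ (‖x‖⁻¹ * g x) * ‖x‖ := by gcongr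
    _ = g x := by field_simp

end IsSolidPointedCone

/-! ### The cone of matrices preserving `K` -/

/-- The matrices that leave the set `K` invariant. -/
def coneMaps {n : ℕ} (K : Set (Fin n → ℝ)) : Set (RMat n) :=
  {A | ∀ x ∈ K, A *ᵥ x ∈ K}

section ConeMaps

variable {n : ℕ} {K : Set (Fin n → ℝ)}

lemma one_mem_coneMaps : (1 : RMat n) ∈ coneMaps K := fun x hx => by simpa using hx

lemma mul_mem_coneMaps {A B : RMat n} (hA : A ∈ coneMaps K) (hB : B ∈ coneMaps K) :
    A * B ∈ coneMaps K := fun x hx => by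
  rw [← Matrix.mulVec_mulVec]
  exact hA _ (hB x hx)

lemma IsSolidPointedCone.smul_mem_coneMaps (hK : IsSolidPointedCone K) {c : ℝ} (hc : 0 ≤ c)
    {A : RMat n} (hA : A ∈ coneMaps K) : c • A ∈ coneMaps K := fun x hx => by
  rw [Matrix.smul_mulVec]
  exact hK.smul_mem c hc _ (hA x hx)

lemma convex_coneMaps (hK : Convex ℝ K) : Convex ℝ (coneMaps K) := by
  intro A hA B hB a b ha hb hab x hx
  rw [Matrix.add_mulVec, Matrix.smul_mulVec, Matrix.smul_mulVec]
  exact hK (hA x hx) (hB x hx) ha hb hab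

lemma isClosed_coneMaps (hK : IsClosed K) : IsClosed (coneMaps K) := by
  have : coneMaps K = ⋂ x ∈ K, {A : RMat n | A *ᵥ x ∈ K} := by
    ext A
    simp [coneMaps]
  rw [this]
  exact isClosed_biInter fun x _ =>
    hK.preimage (Continuous.matrix_mulVec continuous_id continuous_const)

lemma exists_norm_le_of_entries (𝕜 : Type*) [RCLike 𝕜] (n : ℕ) :
    ∃ C : ℝ, 0 < C ∧ ∀ (B : Matrix (Fin n) (Fin n) 𝕜) (r : ℝ), 0 ≤ r → (∀ i j, ‖B i j‖ ≤ r) →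
      ‖B‖ ≤ C * r := by
  refine ⟨∑ i, ∑ j, ‖(Matrix.single i j 1 : Matrix (Fin n) (Fin n) 𝕜)‖ + 1, by positivity,
    fun B r hr0 hr => ?_⟩
  calc ‖B‖ = ‖∑ i, ∑ j, B i j • (Matrix.single i j 1 : Matrix (Fin n) (Fin n) 𝕜)‖ := by
        conv_lhs => rw [Matrix.matrix_eq_sum_single B]
        simp [Matrix.smul_single]
    _ ≤ ∑ i, ∑ j, r * ‖(Matrix.single i j 1 : Matrix (Fin n) (Fin n) 𝕜)‖ := by
      refine (norm_sum_le _ _).trans (Finset.sum_le_sum fun i _ => (norm_sum_le _ _).trans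
        (Finset.sum_le_sum fun j _ => ?_))
      rw [norm_smul]
      gcongr
      exact hr i j
    _ = (∑ i, ∑ j, ‖(Matrix.single i j 1 : Matrix (Fin n) (Fin n) 𝕜)‖) * r := by
      simp only [← Finset.mul_sum]
      ring
    _ ≤ _ := by
      gcongr
      linarith

lemma norm_entry_le_l2_opNorm {𝕜 : Type*} [RCLike 𝕜] (B : Matrix (Fin n) (Fin n) 𝕜)
    (i j : Fin n) : ‖B i j‖ ≤ ‖B‖ := by
  have h := Matrix.l2_opNorm_mulVec B (EuclideanSpace.single j (1 : 𝕜))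
  have h1 : ‖(EuclideanSpace.single j (1 : 𝕜))‖ = 1 := by simp
  rw [h1, mul_one] at h
  refine le_trans ?_ h
  have h2 := PiLp.norm_apply_le
    ((EuclideanSpace.equiv (Fin n) 𝕜).symm (B *ᵥ (EuclideanSpace.single j (1 : 𝕜)))) i
  simpa using h2

/-- On the matrices that leave a solid pointed cone invariant, the norm of `B` is controlled by a
linear functional of the form `φ ⬝ᵥ B *ᵥ x₀`. -/
lemma exists_norm_le_of_mem_coneMaps {φ : Fin n → ℝ} {c : ℝ}
    (hc : 0 < c) (hφ : ∀ x ∈ K, c * ‖x‖ ≤ φ ⬝ᵥ x) {x₀ : Fin n → ℝ} (hx₀ : x₀ ∈ interior K) :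
    ∃ C : ℝ, 0 < C ∧ ∀ B ∈ coneMaps K, ‖B‖ ≤ C * (φ ⬝ᵥ B *ᵥ x₀) := by
  obtain ⟨C, hC, hCn⟩ := exists_norm_le_of_entries ℝ n
  obtain ⟨ε, hε, hball⟩ := Metric.isOpen_iff.1 isOpen_interior x₀ hx₀
  set r := ε / 2 with hr
  have hr0 : 0 < r := half_pos hε
  have hmem : ∀ (v : Fin n → ℝ), ‖v‖ ≤ r → x₀ + v ∈ K := fun v hv =>
    interior_subset (hball (by simp only [Metric.mem_ball, dist_self_add_left]; linarith))
  -- Both `x₀ ± r • e` lie in `K`, so `c * ‖B (x₀ + r • e)‖` is at most twice `φ ⬝ᵥ B *ᵥ x₀`;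
  -- subtracting `B *ᵥ x₀` costs the third copy.
  refine ⟨C * (3 / (c * r)), by positivity, fun B hB => ?_⟩
  rw [mul_assoc]
  have hB0 := hφ _ (hB _ (interior_subset hx₀))
  have hB1 : 0 ≤ φ ⬝ᵥ B *ᵥ x₀ := le_trans (by positivity) hB0
  refine hCn B _ (by positivity) fun i j => ?_
  rw [Real.norm_eq_abs]
  set e : Fin n → ℝ := Pi.single j 1 with he
  have hen : ‖e‖ ≤ 1 := by
    rw [he, pi_norm_le_iff_of_nonneg zero_le_one]
    intro k
    rw [Pi.single_apply]
    split_ifs <;> simp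
  have hre : ‖r • e‖ ≤ r := by
    rw [norm_smul, Real.norm_of_nonneg hr0.le]
    nlinarith
  have h1 := hφ _ (hB _ (hmem _ hre))
  have h2 := hφ _ (hB _ (hmem (-(r • e)) (by rwa [norm_neg])))
  simp only [Matrix.mulVec_add, Matrix.mulVec_neg, dotProduct_add, dotProduct_neg] at h1 h2
  have h4 : 0 ≤ c * ‖B *ᵥ x₀ + -(B *ᵥ (r • e))‖ := by positivity
  have h5 : ‖B *ᵥ (r • e)‖ ≤ ‖B *ᵥ x₀ + B *ᵥ (r • e)‖ + ‖B *ᵥ x₀‖ := by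
    have := norm_sub_le (B *ᵥ x₀ + B *ᵥ (r • e)) (B *ᵥ x₀)
    rwa [add_sub_cancel_left] at this
  have h6 : |r * B i j| ≤ ‖B *ᵥ (r • e)‖ := by
    have := norm_le_pi_norm (B *ᵥ (r • e)) i
    rw [Matrix.mulVec_smul, he, Matrix.mulVec_single_one] at this
    rw [Matrix.mulVec_smul, he, Matrix.mulVec_single_one]
    simpa [Matrix.col_apply] using this
  rw [abs_mul, abs_of_pos hr0] at h6
  have h3 := hB0
  have h7 : c * (r * |B i j|) ≤ 3 * (φ ⬝ᵥ B *ᵥ x₀) := by nlinarith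
  rw [div_mul_eq_mul_div, le_div_iff₀ (by positivity)]
  linarith

/-- A matrix in the interior of the cone of `K`-preserving matrices dominates a rank-one matrix. -/
lemma exists_rankOne_le_of_mem_interior {P : RMat n} (hP : P ∈ interior (coneMaps K))
    (x₀ φ : Fin n → ℝ) :
    ∃ δ : ℝ, 0 < δ ∧ ∀ x ∈ K, P *ᵥ x - (δ * (φ ⬝ᵥ x)) • x₀ ∈ K := by
  have hcont : Tendsto (fun δ : ℝ => P - δ • Matrix.vecMulVec x₀ φ) (𝓝[>] 0) (𝓝 P) := by
    have : Continuous fun δ : ℝ => P - δ • Matrix.vecMulVec x₀ φ := by fun_prop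
    simpa using (this.tendsto 0).mono_left nhdsWithin_le_nhds
  obtain ⟨δ, hδ, hδ0⟩ := ((hcont.eventually (isOpen_interior.mem_nhds hP)).and
    self_mem_nhdsWithin).exists
  refine ⟨δ, hδ0, fun x hx => ?_⟩
  have := interior_subset hδ x hx
  rwa [Matrix.sub_mulVec, Matrix.smul_mulVec, Matrix.vecMulVec_mulVec, op_smul_eq_smul,
    smul_smul] at this

/-- Near a matrix `C` in the interior of the cone of `K`-preserving matrices, all matrices dominate
`s • C`, for `s < 1`. -/
lemma IsSolidPointedCone.eventually_sub_smul_mem (hK : IsSolidPointedCone K) {C : RMat n}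
    (hC : C ∈ interior (coneMaps K)) {s : ℝ} (hs : s < 1) :
    ∀ᶠ D in 𝓝 C, D - s • C ∈ coneMaps K := by
  have h1 : 0 < 1 - s := by linarith
  -- The rescaled difference equals `C` at `D = C`, hence stays interior for `D` near `C`.
  have hcont : Tendsto (fun D : RMat n => (1 - s)⁻¹ • (D - s • C)) (𝓝 C) (𝓝 C) := by
    have : Continuous fun D : RMat n => (1 - s)⁻¹ • (D - s • C) := by fun_prop
    convert this.tendsto C using 2
    rw [show C - s • C = (1 - s) • C by module, smul_smul, inv_mul_cancel₀ h1.ne', one_smul]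
  filter_upwards [hcont.eventually (isOpen_interior.mem_nhds hC)] with D hD
  have := hK.smul_mem_coneMaps h1.le (interior_subset hD)
  rwa [smul_smul, mul_inv_cancel₀ h1.ne', one_smul] at this

end ConeMaps

/-! ### Products of matrices -/

section BackwardProd

variable {n : ℕ}

@[simp]
lemma backwardProd_zero (A : Fin 0 → RMat n) : backwardProd A = 1 := by
  simp [backwardProd]

lemma backwardProd_succ {k : ℕ} (A : Fin (k + 1) → RMat n) :
    backwardProd A = backwardProd (fun i => A i.succ) * A 0 := by
  simp only [backwardProd]
  rw [List.ofFn_succ_last, List.prod_append]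
  simp [Fin.rev_castSucc]

@[fun_prop]
lemma continuous_backwardProd (k : ℕ) :
    Continuous (backwardProd : (Fin k → RMat n) → RMat n) := by
  induction k with
  | zero =>
    rw [funext fun A : Fin 0 → RMat n => backwardProd_zero A]
    exact continuous_const
  | succ k ih =>
    rw [funext fun A : Fin (k + 1) → RMat n => backwardProd_succ A]
    exact (ih.comp (by fun_prop)).mul (by fun_prop)

lemma backwardProd_mem_coneMaps {K : Set (Fin n → ℝ)} {k : ℕ} {A : Fin k → RMat n}
    (hA : ∀ i, A i ∈ coneMaps K) : backwardProd A ∈ coneMaps K := by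
  induction k with
  | zero => simpa using one_mem_coneMaps
  | succ k ih =>
    rw [backwardProd_succ]
    exact mul_mem_coneMaps (ih fun i => hA _) (hA 0)

lemma norm_backwardProd_le {R : ℝ} {k : ℕ} {A : Fin k → RMat n} (hA : ∀ i, ‖A i‖ ≤ R) (hR : 0 ≤ R) :
    ‖backwardProd A‖ ≤ ‖(1 : RMat n)‖ * R ^ k := by
  induction k with
  | zero => simp
  | succ k ih =>
    rw [backwardProd_succ, pow_succ, ← mul_assoc]
    exact (norm_mul_le _ _).trans (mul_le_mul (ih fun i => hA _) (hA 0) (norm_nonneg _)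
      (by positivity))

end BackwardProd

/-! ### Kronecker powers -/

section KroneckerPow

variable {n : ℕ}

lemma kroneckerPow_succ_apply (A : RMat n) (p : ℕ) (i j : Fin (n ^ p)) (a b : Fin n) :
    kroneckerPow A (p + 1) (kroneckerIdx n p (i, a)) (kroneckerIdx n p (j, b)) =
      kroneckerPow A p i j * A a b := by
  simp [kroneckerPow]

@[simp]
lemma kroneckerPow_one (p : ℕ) : kroneckerPow (1 : RMat n) p = 1 := by
  induction p with
  | zero => rfl
  | succ p ih =>
    rw [kroneckerPow, ih, Matrix.one_kronecker_one, Matrix.reindex_apply,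
      Matrix.submatrix_one_equiv]

lemma kroneckerPow_mul (A B : RMat n) (p : ℕ) :
    kroneckerPow (A * B) p = kroneckerPow A p * kroneckerPow B p := by
  induction p with
  | zero => exact (mul_one (1 : RMat (n ^ 0))).symm
  | succ p ih =>
    simp only [kroneckerPow]
    rw [ih, Matrix.mul_kronecker_mul]
    simp

@[fun_prop]
lemma continuous_kroneckerPow (p : ℕ) (i j : Fin (n ^ p)) :
    Continuous fun A : RMat n => kroneckerPow A p i j := by
  induction p with
  | zero => exact continuous_const
  | succ p ih =>
    obtain ⟨⟨i, a⟩, rfl⟩ := (kroneckerIdx n p).surjective i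
    obtain ⟨⟨j, b⟩, rfl⟩ := (kroneckerIdx n p).surjective j
    simp only [kroneckerPow_succ_apply]
    exact (ih i j).mul (by fun_prop)

lemma abs_kroneckerPow_le (A : RMat n) (p : ℕ) (i j : Fin (n ^ p)) :
    |kroneckerPow A p i j| ≤ ‖A‖ ^ p := by
  induction p with
  | zero =>
    simp only [kroneckerPow, Matrix.one_apply, pow_zero]
    split_ifs <;> simp
  | succ p ih =>
    obtain ⟨⟨i, a⟩, rfl⟩ := (kroneckerIdx n p).surjective i
    obtain ⟨⟨j, b⟩, rfl⟩ := (kroneckerIdx n p).surjective j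
    rw [kroneckerPow_succ_apply, abs_mul, pow_succ]
    exact mul_le_mul (ih i j) (norm_entry_le_l2_opNorm A a b) (abs_nonneg _) (by positivity)

/-- The `p`-th power of a linear functional of `A` is a linear functional of `A^{⊗p}`. -/
lemma exists_pow_eq_sum_kroneckerPow (φ x : Fin n → ℝ) (p : ℕ) :
    ∃ w : Fin (n ^ p) → Fin (n ^ p) → ℝ, ∀ B : RMat n,
      (φ ⬝ᵥ B *ᵥ x) ^ p = ∑ i, ∑ j, w i j * kroneckerPow B p i j := by
  induction p with
  | zero =>
    refine ⟨fun _ _ => 1, fun B => ?_⟩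
    change (1 : ℝ) = ∑ i : Fin 1, ∑ j : Fin 1, 1 * (1 : Matrix (Fin 1) (Fin 1) ℝ) i j
    simp
  | succ p ih =>
    obtain ⟨w, hw⟩ := ih
    refine ⟨fun i j => w ((kroneckerIdx n p).symm i).1 ((kroneckerIdx n p).symm j).1 *
      (φ ((kroneckerIdx n p).symm i).2 * x ((kroneckerIdx n p).symm j).2), fun B => ?_⟩
    rw [← (kroneckerIdx n p).sum_comp]
    simp_rw [← (kroneckerIdx n p).sum_comp (fun j => _ * kroneckerPow B (p + 1) _ j)]
    simp only [Equiv.symm_apply_apply, Fintype.sum_prod_type, kroneckerPow_succ_apply]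
    rw [pow_succ, hw B, Finset.sum_mul]
    refine Finset.sum_congr rfl fun i _ => ?_
    rw [Finset.sum_mul, Finset.sum_comm' (t' := Finset.univ) (s' := fun _ => Finset.univ) (by simp)]
    refine Finset.sum_congr rfl fun j _ => ?_
    simp only [dotProduct, Matrix.mulVec, Finset.mul_sum]
    refine Finset.sum_congr rfl fun a _ => Finset.sum_congr rfl fun b _ => ?_
    ring

end KroneckerPow

/-! ### Expected Kronecker powers of random products -/

section Integrals

variable {n : ℕ} {μ : Measure (RMat n)} [IsProbabilityMeasure μ]

lemma measurePreserving_finCons {X : Type*} [MeasurableSpace X] (μ : Measure X) [SigmaFinite μ]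
    (k : ℕ) :
    MeasurePreserving (fun z : X × (Fin k → X) => (Fin.cons z.1 z.2 : Fin (k + 1) → X))
      (μ.prod (Measure.pi fun _ => μ)) (Measure.pi fun _ => μ) := by
  have := (measurePreserving_piFinSuccAbove (fun _ : Fin (k + 1) => μ) 0).symm
  convert this using 1
  ext z i
  simp [MeasurableEquiv.piFinSuccAbove_symm_apply, Fin.insertNthEquiv]

lemma lintegral_backwardProd_succ {F : RMat n → ℝ≥0∞} (hF : Measurable F) (k : ℕ) :
    ∫⁻ A : Fin (k + 1) → RMat n, F (backwardProd A) ∂(Measure.pi fun _ => μ) =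
      ∫⁻ B, ∫⁻ A : Fin k → RMat n, F (backwardProd A * B) ∂(Measure.pi fun _ => μ) ∂μ := by
  have hm : Measurable fun A : Fin (k + 1) → RMat n => F (backwardProd A) :=
    hF.comp (continuous_backwardProd _).measurable
  rw [← (measurePreserving_finCons μ k).lintegral_comp hm, lintegral_prod]
  · simp [backwardProd_succ]
  · exact (hm.comp (measurePreserving_finCons μ k).measurable).aemeasurable

lemma ae_pi_mem_support (k : ℕ) :
    ∀ᵐ A : Fin k → RMat n ∂(Measure.pi fun _ => μ), ∀ i, A i ∈ μ.support :=
  eventually_all.2 fun i => (Measure.tendsto_eval_ae_ae (μ := fun _ : Fin k => μ)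
    (i := i)).eventually Measure.support_mem_ae

lemma integrable_kroneckerPow (hbdd : Bornology.IsBounded μ.support) (p : ℕ) (i j : Fin (n ^ p)) :
    Integrable (fun A => kroneckerPow A p i j) μ := by
  obtain ⟨R, hR⟩ := hbdd.exists_norm_le
  refine Integrable.of_bound (C := R ^ p) (continuous_kroneckerPow p i j).aestronglyMeasurable ?_
  filter_upwards [(Measure.support_mem_ae : μ.support ∈ ae μ)] with A hA
  exact (abs_kroneckerPow_le A p i j).trans (by gcongr; exact hR A hA)

/-- The entries of `(A_k ⋯ A_1)^{⊗p}` are integrable, with expected values those of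
`E[A^{⊗p}]^k`. -/
lemma integral_kroneckerPow_backwardProd {p : ℕ}
    (hint : ∀ i j, Integrable (fun A => kroneckerPow A p i j) μ) (k : ℕ) (i j : Fin (n ^ p)) :
    Integrable (fun A : Fin k → RMat n => kroneckerPow (backwardProd A) p i j)
      (Measure.pi fun _ => μ) ∧
    ∫ A : Fin k → RMat n, kroneckerPow (backwardProd A) p i j ∂(Measure.pi fun _ => μ) =
      (expKroneckerPow μ p ^ k) i j := by
  induction k generalizing i j with
  | zero => simp
  | succ k ih =>
    have hmp := measurePreserving_finCons μ k
    have hc : Continuous fun A : Fin (k + 1) → RMat n => kroneckerPow (backwardProd A) p i j :=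
      (continuous_kroneckerPow p i j).comp (continuous_backwardProd _)
    -- Multiplicativity splits off the first factor; in each summand the two terms are independent,
    -- so expectations multiply.
    have heq : (fun z : RMat n × (Fin k → RMat n) =>
        kroneckerPow (backwardProd (Fin.cons z.1 z.2 : Fin (k + 1) → RMat n)) p i j) =
        fun z => ∑ l, kroneckerPow z.1 p l j * kroneckerPow (backwardProd z.2) p i l := by
      ext z
      simp [backwardProd_succ, kroneckerPow_mul, Matrix.mul_apply, mul_comm]
    have hI : ∀ l, Integrable (fun z : RMat n × (Fin k → RMat n) =>
        kroneckerPow z.1 p l j * kroneckerPow (backwardProd z.2) p i l)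
        (μ.prod (Measure.pi fun _ => μ)) := fun l => (hint l j).mul_prod (ih i l).1
    constructor
    · rw [← hmp.integrable_comp hc.aestronglyMeasurable]
      change Integrable (fun z : RMat n × (Fin k → RMat n) =>
        kroneckerPow (backwardProd (Fin.cons z.1 z.2 : Fin (k + 1) → RMat n)) p i j) _
      rw [heq]
      exact integrable_finsetSum _ fun l _ => hI l
    · rw [← hmp.map_eq, integral_map hmp.measurable.aemeasurable hc.aestronglyMeasurable, heq,
        integral_finsetSum _ fun l _ => hI l, pow_succ, Matrix.mul_apply]
      refine Finset.sum_congr rfl fun l _ => ?_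
      rw [integral_prod_mul (fun A => kroneckerPow A p l j)
        (fun A => kroneckerPow (backwardProd A) p i l), (ih i l).2, mul_comm]
      rfl

end Integrals

/-! ### Exponential growth rates -/

section Roots

lemma ENNReal.tendsto_const_rpow_one_div_nat {c : ℝ≥0∞} (h0 : c ≠ 0) (hc : c ≠ ⊤) :
    Tendsto (fun k : ℕ => c ^ (1 / (k : ℝ))) atTop (𝓝 1) := by
  have hpos : 0 < c.toReal := ENNReal.toReal_pos h0 hc
  have h1 : Tendsto (fun k : ℕ => c.toReal ^ (1 / (k : ℝ))) atTop (𝓝 1) := by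
    have := (Real.continuous_const_rpow hpos.ne').tendsto 0
    rw [Real.rpow_zero] at this
    exact this.comp tendsto_one_div_atTop_nhds_zero_nat
  have h2 := (ENNReal.continuous_ofReal.tendsto 1).comp h1
  rw [ENNReal.ofReal_one] at h2
  refine h2.congr fun k => ?_
  rw [Function.comp_apply, ← ENNReal.ofReal_rpow_of_pos hpos, ENNReal.ofReal_toReal hc]

/-- Multiplying a sequence by a constant does not change its exponential growth rate. -/
lemma ENNReal.tendsto_const_mul_rpow_one_div {c : ℝ≥0∞} (h0 : c ≠ 0) (hc : c ≠ ⊤) {a : ℕ → ℝ≥0∞}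
    {r : ℝ≥0∞} (ha : Tendsto (fun k : ℕ => a k ^ (1 / (k : ℝ))) atTop (𝓝 r)) :
    Tendsto (fun k : ℕ => (c * a k) ^ (1 / (k : ℝ))) atTop (𝓝 r) := by
  have := ENNReal.Tendsto.mul (ENNReal.tendsto_const_rpow_one_div_nat h0 hc) (Or.inl one_ne_zero)
    ha (Or.inr ENNReal.one_ne_top)
  rw [one_mul] at this
  exact this.congr fun k => (ENNReal.mul_rpow_of_nonneg _ _ (by positivity)).symm

lemma ENNReal.tendsto_rpow_one_div_of_le_of_le {c d : ℝ≥0∞} (h0 : c ≠ 0) (hc : c ≠ ⊤)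
    (hd0 : d ≠ 0) (hd : d ≠ ⊤) {a v : ℕ → ℝ≥0∞} {r : ℝ≥0∞} (hav : ∀ k, a k ≤ c * v k)
    (hva : ∀ k, v k ≤ d * a k) (ha : Tendsto (fun k : ℕ => a k ^ (1 / (k : ℝ))) atTop (𝓝 r)) :
    Tendsto (fun k : ℕ => v k ^ (1 / (k : ℝ))) atTop (𝓝 r) := by
  refine tendsto_of_tendsto_of_tendsto_of_le_of_le
    (ENNReal.tendsto_const_mul_rpow_one_div (ENNReal.inv_ne_zero.2 hc) (ENNReal.inv_ne_top.2 h0) ha)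
    (ENNReal.tendsto_const_mul_rpow_one_div hd0 hd ha) (fun k => ?_) fun k => ?_
  · refine ENNReal.rpow_le_rpow ?_ (by positivity)
    calc c⁻¹ * a k ≤ c⁻¹ * (c * v k) := by gcongr; exact hav k
      _ = v k := by rw [← mul_assoc, ENNReal.inv_mul_cancel h0 hc, one_mul]
  · exact ENNReal.rpow_le_rpow (hva k) (by positivity)

end Roots

/-! ### The `p`-radius as a spectral radius -/

section PRadius

variable {n : ℕ}

/-- `E[(φ ⬝ A_k ⋯ A_1 x)₊ ^ p]`, for independent `A_1, …, A_k` following `μ`. -/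
noncomputable def coneMoment (μ : Measure (RMat n)) [SigmaFinite μ] (φ : Fin n → ℝ) (p k : ℕ)
    (x : Fin n → ℝ) : ℝ≥0∞ :=
  ∫⁻ A : Fin k → RMat n, ENNReal.ofReal (φ ⬝ᵥ backwardProd A *ᵥ x) ^ p ∂(Measure.pi fun _ => μ)

/-- The complexification of `E[A^{⊗p}]`. -/
noncomputable def complexExpKroneckerPow (μ : Measure (RMat n)) (p : ℕ) :
    Matrix (Fin (n ^ p)) (Fin (n ^ p)) ℂ :=
  (expKroneckerPow μ p).map Complex.ofReal

lemma complexExpKroneckerPow_pow_apply (μ : Measure (RMat n)) (p k : ℕ) (i j : Fin (n ^ p)) :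
    (complexExpKroneckerPow μ p ^ k) i j = ((expKroneckerPow μ p ^ k) i j : ℂ) := by
  have := map_pow (Complex.ofRealHom.mapMatrix (m := Fin (n ^ p))) (expKroneckerPow μ p) k
  exact (congrFun (congrFun this i) j).symm

variable {μ : Measure (RMat n)} [IsProbabilityMeasure μ]

/-- Each entry of `E[A^{⊗p}]^k` is the mean of an entry of `(A_k ⋯ A_1)^{⊗p}`, which is bounded by
`‖A_k ⋯ A_1‖^p`. -/
lemma exists_enorm_complexExpKroneckerPow_pow_le {p : ℕ}
    (hint : ∀ i j, Integrable (fun A => kroneckerPow A p i j) μ) :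
    ∃ c : ℝ≥0∞, c ≠ 0 ∧ c ≠ ⊤ ∧ ∀ k : ℕ, ‖complexExpKroneckerPow μ p ^ k‖ₑ ≤
      c * ∫⁻ A : Fin k → RMat n, ‖backwardProd A‖ₑ ^ p ∂(Measure.pi fun _ => μ) := by
  obtain ⟨C, hC, hCn⟩ := exists_norm_le_of_entries ℂ (n ^ p)
  refine ⟨ENNReal.ofReal C, by simpa using hC, ENNReal.ofReal_ne_top, fun k => ?_⟩
  set v := ∫⁻ A : Fin k → RMat n, ‖backwardProd A‖ₑ ^ p ∂(Measure.pi fun _ => μ) with hv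
  rcases eq_or_ne v ⊤ with hvt | hvt
  · rw [hvt, ENNReal.mul_top (by simpa using hC)]
    exact le_top
  have hentry : ∀ i j, ‖(complexExpKroneckerPow μ p ^ k) i j‖ ≤ v.toReal := by
    intro i j
    rw [complexExpKroneckerPow_pow_apply, Complex.norm_real,
      ← (integral_kroneckerPow_backwardProd hint k i j).2, ← toReal_enorm]
    refine ENNReal.toReal_mono hvt ((enorm_integral_le_lintegral_enorm _).trans
      (lintegral_mono fun A => ?_))
    have := abs_kroneckerPow_le (backwardProd A) p i j
    rw [← ofReal_norm, ← ofReal_norm, ← ENNReal.ofReal_pow (norm_nonneg _)]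
    exact ENNReal.ofReal_le_ofReal this
  have := hCn _ _ ENNReal.toReal_nonneg hentry
  rw [← ofReal_norm, ← ENNReal.ofReal_toReal hvt, ← ENNReal.ofReal_mul hC.le]
  exact ENNReal.ofReal_le_ofReal this

lemma ae_backwardProd_mem_coneMaps {K : Set (Fin n → ℝ)} (hinv : LeavesInvariant μ.support K)
    (k : ℕ) : ∀ᵐ A : Fin k → RMat n ∂(Measure.pi fun _ => μ), backwardProd A ∈ coneMaps K :=
  (ae_pi_mem_support k).mono fun _ hA => backwardProd_mem_coneMaps fun i => hinv _ (hA i)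

lemma exists_coneMoment_le {K : Set (Fin n → ℝ)} (hinv : LeavesInvariant μ.support K)
    {φ : Fin n → ℝ} (hφ : ∀ x ∈ K, 0 ≤ φ ⬝ᵥ x) {x : Fin n → ℝ} (hx : x ∈ K) {p : ℕ}
    (hint : ∀ i j, Integrable (fun A => kroneckerPow A p i j) μ) :
    ∃ c : ℝ≥0∞, c ≠ 0 ∧ c ≠ ⊤ ∧ ∀ k : ℕ,
      coneMoment μ φ p k x ≤ c * ‖complexExpKroneckerPow μ p ^ k‖ₑ := by
  obtain ⟨w, hw⟩ := exists_pow_eq_sum_kroneckerPow φ x p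
  have hc : (0 : ℝ) < ∑ i, ∑ j, |w i j| + 1 := by positivity
  refine ⟨ENNReal.ofReal (∑ i, ∑ j, |w i j| + 1), by simpa using hc, ENNReal.ofReal_ne_top,
    fun k => ?_⟩
  have hI := fun i j => integral_kroneckerPow_backwardProd hint k i j
  have hI2 : ∀ i j, Integrable (fun A : Fin k → RMat n =>
      w i j * kroneckerPow (backwardProd A) p i j) (Measure.pi fun _ => μ) :=
    fun i j => (hI i j).1.const_mul _
  have hsum : ∫ A : Fin k → RMat n, (φ ⬝ᵥ backwardProd A *ᵥ x) ^ p ∂(Measure.pi fun _ => μ) =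
      ∑ i, ∑ j, w i j * (expKroneckerPow μ p ^ k) i j := by
    simp_rw [hw]
    rw [integral_finsetSum _ fun i _ => integrable_finsetSum _ fun j _ => hI2 i j]
    refine Finset.sum_congr rfl fun i _ => ?_
    rw [integral_finsetSum _ fun j _ => hI2 i j]
    refine Finset.sum_congr rfl fun j _ => ?_
    rw [integral_const_mul, (hI i j).2]
  have hint2 : Integrable (fun A : Fin k → RMat n => (φ ⬝ᵥ backwardProd A *ᵥ x) ^ p)
      (Measure.pi fun _ => μ) := by
    simp_rw [hw]
    exact integrable_finsetSum _ fun i _ => integrable_finsetSum _ fun j _ => hI2 i j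
  -- Almost every product preserves `K`, so the truncation by `ENNReal.ofReal` loses nothing and the
  -- moment is linear in `E[A^{⊗p}]^k`, also for odd `p`.
  have hnn : ∀ᵐ A : Fin k → RMat n ∂(Measure.pi fun _ => μ), 0 ≤ φ ⬝ᵥ backwardProd A *ᵥ x :=
    (ae_backwardProd_mem_coneMaps hinv k).mono fun A hA => hφ _ (hA x hx)
  have hcm : coneMoment μ φ p k x =
      ENNReal.ofReal (∑ i, ∑ j, w i j * (expKroneckerPow μ p ^ k) i j) := by
    rw [← hsum, ofReal_integral_eq_lintegral_ofReal hint2 (hnn.mono fun A hA => pow_nonneg hA p)]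
    exact lintegral_congr_ae (hnn.mono fun A hA => (ENNReal.ofReal_pow hA p).symm)
  rw [hcm, ← ofReal_norm, ← ENNReal.ofReal_mul hc.le]
  refine ENNReal.ofReal_le_ofReal ?_
  calc ∑ i, ∑ j, w i j * (expKroneckerPow μ p ^ k) i j
      ≤ ∑ i, ∑ j, |w i j| * ‖complexExpKroneckerPow μ p ^ k‖ := by
        refine Finset.sum_le_sum fun i _ => Finset.sum_le_sum fun j _ => ?_
        refine (le_abs_self _).trans ?_
        rw [abs_mul]
        gcongr
        have := norm_entry_le_l2_opNorm (complexExpKroneckerPow μ p ^ k) i j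
        rwa [complexExpKroneckerPow_pow_apply, Complex.norm_real] at this
    _ = (∑ i, ∑ j, |w i j|) * ‖complexExpKroneckerPow μ p ^ k‖ := by
      simp only [Finset.sum_mul]
    _ ≤ _ := by
      gcongr
      linarith

lemma lintegral_enorm_backwardProd_le {K : Set (Fin n → ℝ)} (hinv : LeavesInvariant μ.support K)
    {φ x : Fin n → ℝ} {C : ℝ} (hC : 0 < C) (hCB : ∀ B ∈ coneMaps K, ‖B‖ ≤ C * (φ ⬝ᵥ B *ᵥ x))
    (p k : ℕ) :
    ∫⁻ A : Fin k → RMat n, ‖backwardProd A‖ₑ ^ p ∂(Measure.pi fun _ => μ) ≤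
      ENNReal.ofReal C ^ p * coneMoment μ φ p k x := by
  rw [coneMoment, ← lintegral_const_mul' _ _ (by finiteness)]
  refine lintegral_mono_ae ((ae_backwardProd_mem_coneMaps hinv k).mono fun A hA => ?_)
  rw [← mul_pow, ← ENNReal.ofReal_mul hC.le, ← ofReal_norm]
  gcongr
  exact hCB _ hA

lemma tendsto_enorm_complexExpKroneckerPow (μ : Measure (RMat n)) (p : ℕ) :
    Tendsto (fun k : ℕ => ‖complexExpKroneckerPow μ p ^ k‖ₑ ^ (1 / (k : ℝ))) atTop
      (𝓝 (realSpectralRadius (expKroneckerPow μ p))) :=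
  spectrum.pow_nnnorm_pow_one_div_tendsto_nhds_spectralRadius (complexExpKroneckerPow μ p)

/-- For a distribution on matrices that leave a proper cone invariant, the `p`-radius is the
`p`-th root of the spectral radius of `E[A^{⊗p}]`. -/
theorem tendsto_pMean_of_leavesProperConeInvariant (hcone : LeavesProperConeInvariant μ.support)
    {p : ℕ} (hint : ∀ i j, Integrable (fun A => kroneckerPow A p i j) μ) :
    Tendsto (pMean μ p) atTop (𝓝 (realSpectralRadius (expKroneckerPow μ p) ^ (1 / (p : ℝ)))) := by
  obtain ⟨K, hK, hinv⟩ := hcone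
  obtain ⟨φ, c, hc, hφ⟩ := hK.exists_strictlyPositive
  obtain ⟨x, hx⟩ := hK.solid
  obtain ⟨C, hC, hCB⟩ := exists_norm_le_of_mem_coneMaps hc hφ hx
  obtain ⟨c₁, h10, h1t, h1⟩ := exists_enorm_complexExpKroneckerPow_pow_le hint
  obtain ⟨c₂, h20, h2t, h2⟩ := exists_coneMoment_le hinv
    (fun y hy => le_trans (by positivity) (hφ y hy)) (interior_subset hx) hint
  have hC0 : ENNReal.ofReal C ≠ 0 := by simpa using hC
  have := ENNReal.tendsto_rpow_one_div_of_le_of_le (d := ENNReal.ofReal C ^ p * c₂) h10 h1t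
    (mul_ne_zero (pow_ne_zero _ hC0) h20) (by finiteness) h1
    (fun k => (lintegral_enorm_backwardProd_le hinv hC hCB p k).trans (by
      rw [mul_assoc]
      gcongr
      exact h2 k)) (tendsto_enorm_complexExpKroneckerPow μ p)
  refine (this.ennrpow_const (1 / (p : ℝ))).congr fun k => ?_
  rw [pMean, ← ENNReal.rpow_mul, one_div_mul_one_div, mul_comm (k : ℝ)]

end PRadius

/-! ### Finiteness and the upper bound -/

section UpperBound

variable {n : ℕ}

lemma jointSpectralRadius_ne_top {M : Set (RMat n)} (hM : Bornology.IsBounded M) :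
    jointSpectralRadius M ≠ ⊤ := by
  obtain ⟨R, hR0, hR⟩ := hM.exists_pos_norm_le
  -- `1 ≤ D` ensures `D ^ (1 / k) ≤ D`; `‖1‖` itself vanishes for `n = 0`.
  set D : ℝ≥0∞ := max ‖(1 : RMat n)‖ₑ 1 with hD
  have hDt : D ≠ ⊤ := by simp [hD]
  refine ne_top_of_le_ne_top (b := D * ENNReal.ofReal R) (by finiteness) ?_
  refine limsup_le_of_le (by isBoundedDefault) ?_
  filter_upwards [eventually_ge_atTop 1] with k hk
  have hk' : (1 : ℝ) ≤ k := by exact_mod_cast hk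
  refine iSup₂_le fun A hA => ?_
  have h1 : ‖backwardProd A‖ₑ ≤ D * ENNReal.ofReal R ^ k := by
    calc ‖backwardProd A‖ₑ ≤ ‖(1 : RMat n)‖ₑ * ENNReal.ofReal R ^ k := by
          rw [← ofReal_norm, ← ofReal_norm, ← ENNReal.ofReal_pow hR0.le,
            ← ENNReal.ofReal_mul (norm_nonneg _)]
          exact ENNReal.ofReal_le_ofReal (norm_backwardProd_le (fun i => hR _ (hA i)) hR0.le)
      _ ≤ _ := by
        gcongr
        exact le_max_left _ _
  calc ‖backwardProd A‖ₑ ^ (1 / (k : ℝ)) ≤ (D * ENNReal.ofReal R ^ k) ^ (1 / (k : ℝ)) :=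
        ENNReal.rpow_le_rpow h1 (by positivity)
    _ = D ^ (1 / (k : ℝ)) * ENNReal.ofReal R := by
      rw [ENNReal.mul_rpow_of_nonneg _ _ (by positivity), one_div, ENNReal.pow_rpow_inv_natCast
        (by omega)]
    _ ≤ D ^ (1 : ℝ) * ENNReal.ofReal R := by
      gcongr
      · exact le_max_right _ _
      · exact (div_le_one (by linarith)).2 hk'
    _ = _ := by rw [ENNReal.rpow_one]

lemma pMean_le_iSup (μ : Measure (RMat n)) [IsProbabilityMeasure μ] {p k : ℕ} (hp : 1 ≤ p)
    (hk : 1 ≤ k) :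
    pMean μ p k ≤ ⨆ (A : Fin k → RMat n) (_ : ∀ i, A i ∈ μ.support),
      ‖backwardProd A‖ₑ ^ (1 / (k : ℝ)) := by
  set S := ⨆ (A : Fin k → RMat n) (_ : ∀ i, A i ∈ μ.support), ‖backwardProd A‖ₑ ^ (1 / (k : ℝ))
    with hS
  have h1 : ∫⁻ A : Fin k → RMat n, ‖backwardProd A‖ₑ ^ p ∂(Measure.pi fun _ => μ) ≤
      S ^ (p * k) := by
    calc _ ≤ ∫⁻ A : Fin k → RMat n, S ^ (p * k) ∂(Measure.pi fun _ => μ) := by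
          refine lintegral_mono_ae ((ae_pi_mem_support k).mono fun A hA => ?_)
          rw [mul_comm, pow_mul]
          gcongr
          calc ‖backwardProd A‖ₑ = (‖backwardProd A‖ₑ ^ (1 / (k : ℝ))) ^ k := by
                rw [one_div, ENNReal.rpow_inv_natCast_pow (by omega)]
            _ ≤ S ^ k := by
              gcongr
              exact le_iSup₂ (f := fun (A : Fin k → RMat n) (_ : ∀ i, A i ∈ μ.support) =>
                ‖backwardProd A‖ₑ ^ (1 / (k : ℝ))) A hA
      _ = _ := by simp
  calc pMean μ p k ≤ (S ^ (p * k)) ^ (1 / ((p : ℝ) * (k : ℝ))) :=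
        ENNReal.rpow_le_rpow h1 (by positivity)
    _ = S := by
      have : p * k ≠ 0 := by positivity
      rw [one_div, ← Nat.cast_mul, ENNReal.pow_rpow_inv_natCast this]

lemma le_jointSpectralRadius_of_tendsto_pMean {μ : Measure (RMat n)} [IsProbabilityMeasure μ]
    {p : ℕ} (hp : 1 ≤ p) {r : ℝ≥0∞} (h : Tendsto (pMean μ p) atTop (𝓝 r)) :
    r ≤ jointSpectralRadius μ.support := by
  rw [← h.limsup_eq]
  refine limsup_le_limsup ?_
  filter_upwards [eventually_ge_atTop 1] with k hk
  exact pMean_le_iSup μ hp hk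

end UpperBound

/-! ### The lower bound by domination -/

section ConeMoment

variable {n : ℕ} {K : Set (Fin n → ℝ)} {μ : Measure (RMat n)} [IsProbabilityMeasure μ]

lemma backwardProd_snoc {k : ℕ} (A : Fin k → RMat n) (P : RMat n) :
    backwardProd (Fin.snoc A P : Fin (k + 1) → RMat n) = P * backwardProd A := by
  simp only [backwardProd]
  rw [List.ofFn_succ, List.prod_cons]
  simp [Fin.rev_succ]

/-- The matrices that dominate `s • C` in the order of the cone of `K`-preserving matrices. -/
def dominating (K : Set (Fin n → ℝ)) (s : ℝ) (C : RMat n) : Set (RMat n) :=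
  {D | D - s • C ∈ coneMaps K}

lemma measurableSet_dominating (hK : IsClosed K) (s : ℝ) (C : RMat n) :
    MeasurableSet (dominating K s C) :=
  ((isClosed_coneMaps hK).preimage (f := fun D : RMat n => D - s • C) (by fun_prop)).measurableSet

lemma coneMoment_zero (φ x : Fin n → ℝ) (p : ℕ) :
    coneMoment μ φ p 0 x = ENNReal.ofReal (φ ⬝ᵥ x) ^ p := by
  simp [coneMoment]

lemma coneMoment_succ (φ x : Fin n → ℝ) (p k : ℕ) :
    coneMoment μ φ p (k + 1) x = ∫⁻ B, coneMoment μ φ p k (B *ᵥ x) ∂μ := by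
  have hm : Measurable fun B : RMat n => ENNReal.ofReal (φ ⬝ᵥ B *ᵥ x) ^ p := by
    have : Continuous fun B : RMat n => φ ⬝ᵥ B *ᵥ x :=
      Continuous.dotProduct continuous_const (Continuous.matrix_mulVec continuous_id continuous_const)
    exact (this.measurable.ennreal_ofReal).pow_const p
  simp only [coneMoment]
  rw [lintegral_backwardProd_succ hm]
  simp only [Matrix.mulVec_mulVec]

lemma coneMoment_smul (φ x : Fin n → ℝ) (p k : ℕ) {c : ℝ} (hc : 0 ≤ c) :
    coneMoment μ φ p k (c • x) = ENNReal.ofReal c ^ p * coneMoment μ φ p k x := by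
  rw [coneMoment, coneMoment, ← lintegral_const_mul' _ _ (by finiteness)]
  refine lintegral_congr fun A => ?_
  rw [Matrix.mulVec_smul, dotProduct_smul, smul_eq_mul, ENNReal.ofReal_mul hc, mul_pow]

lemma coneMoment_mono (hinv : LeavesInvariant μ.support K) {φ : Fin n → ℝ}
    (hφ : ∀ x ∈ K, 0 ≤ φ ⬝ᵥ x) {x y : Fin n → ℝ} (hxy : y - x ∈ K) (p k : ℕ) :
    coneMoment μ φ p k x ≤ coneMoment μ φ p k y := by
  refine lintegral_mono_ae ((ae_backwardProd_mem_coneMaps hinv k).mono fun A hA => ?_)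
  have := hφ _ (hA _ hxy)
  rw [Matrix.mulVec_sub, dotProduct_sub] at this
  gcongr
  linarith

lemma measure_dominating_mul_coneMoment_le (hK : IsClosed K) (hinv : LeavesInvariant μ.support K)
    {φ : Fin n → ℝ} (hφ : ∀ x ∈ K, 0 ≤ φ ⬝ᵥ x) {x : Fin n → ℝ} (hx : x ∈ K) {s : ℝ} (hs : 0 ≤ s)
    (C : RMat n) (p k : ℕ) :
    μ (dominating K s C) * ENNReal.ofReal s ^ p * coneMoment μ φ p k (C *ᵥ x) ≤
      coneMoment μ φ p (k + 1) x := by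
  calc _ = ∫⁻ _ in dominating K s C, coneMoment μ φ p k (s • (C *ᵥ x)) ∂μ := by
        rw [setLIntegral_const, coneMoment_smul _ _ _ _ hs]
        ring
    _ ≤ ∫⁻ B in dominating K s C, coneMoment μ φ p k (B *ᵥ x) ∂μ := by
      refine setLIntegral_mono' (measurableSet_dominating hK s C) fun D hD => ?_
      refine coneMoment_mono hinv hφ ?_ p k
      have := hD x hx
      rwa [Matrix.sub_mulVec, Matrix.smul_mulVec] at this
    _ ≤ ∫⁻ B, coneMoment μ φ p k (B *ᵥ x) ∂μ := setLIntegral_le_lintegral _ _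
    _ = _ := (coneMoment_succ φ x p k).symm

/-- Require the first `k` random factors to dominate `s • C 0`, `s • C 1`, … in turn: each step
costs a probability at least `q` and a scaling `s ^ p`. -/
lemma pow_mul_coneMoment_backwardProd_le (hK : IsClosed K) (hinv : LeavesInvariant μ.support K)
    {φ : Fin n → ℝ} (hφ : ∀ x ∈ K, 0 ≤ φ ⬝ᵥ x) {s : ℝ} (hs : 0 ≤ s) {q : ℝ≥0∞} {k : ℕ}
    {C : Fin k → RMat n} (hC : ∀ i, C i ∈ coneMaps K) (hq : ∀ i, q ≤ μ (dominating K s (C i)))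
    (p j : ℕ) {x : Fin n → ℝ} (hx : x ∈ K) :
    (q * ENNReal.ofReal s ^ p) ^ k * coneMoment μ φ p j (backwardProd C *ᵥ x) ≤
      coneMoment μ φ p (j + k) x := by
  induction k generalizing x with
  | zero => simp
  | succ k ih =>
    calc _ = (q * ENNReal.ofReal s ^ p) * ((q * ENNReal.ofReal s ^ p) ^ k *
          coneMoment μ φ p j (backwardProd (fun i => C i.succ) *ᵥ (C 0 *ᵥ x))) := by
          rw [backwardProd_succ, Matrix.mulVec_mulVec]
          ring
      _ ≤ (μ (dominating K s (C 0)) * ENNReal.ofReal s ^ p) *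
          coneMoment μ φ p (j + k) (C 0 *ᵥ x) := by
        gcongr
        · exact hq 0
        · exact ih (fun i => hC _) (fun i => hq _) (hC 0 x hx)
      _ ≤ _ := measure_dominating_mul_coneMoment_le hK hinv hφ hx hs _ _ _

/-- The product of the block maps `x` above `l • x`, so the block can be repeated `m` times, gaining
`l ^ p` each time. -/
lemma pow_mul_coneMoment_zero_le (hK : IsClosed K) (hinv : LeavesInvariant μ.support K)
    {φ : Fin n → ℝ} (hφ : ∀ x ∈ K, 0 ≤ φ ⬝ᵥ x) {s : ℝ} (hs : 0 ≤ s) {q : ℝ≥0∞} {k : ℕ}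
    {C : Fin k → RMat n} (hC : ∀ i, C i ∈ coneMaps K) (hq : ∀ i, q ≤ μ (dominating K s (C i)))
    {x : Fin n → ℝ} (hx : x ∈ K) {l : ℝ} (hl : 0 ≤ l) (hlx : backwardProd C *ᵥ x - l • x ∈ K)
    (p m : ℕ) :
    ((q * ENNReal.ofReal s ^ p) ^ k * ENNReal.ofReal l ^ p) ^ m * coneMoment μ φ p 0 x ≤
      coneMoment μ φ p (k * m) x := by
  induction m with
  | zero => simp
  | succ m ih =>
    calc _ = ((q * ENNReal.ofReal s ^ p) ^ k * ENNReal.ofReal l ^ p) *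
          (((q * ENNReal.ofReal s ^ p) ^ k * ENNReal.ofReal l ^ p) ^ m *
            coneMoment μ φ p 0 x) := by ring
      _ ≤ ((q * ENNReal.ofReal s ^ p) ^ k * ENNReal.ofReal l ^ p) * coneMoment μ φ p (k * m) x := by
        gcongr
      _ = (q * ENNReal.ofReal s ^ p) ^ k * coneMoment μ φ p (k * m) (l • x) := by
        rw [coneMoment_smul _ _ _ _ hl]
        ring
      _ ≤ (q * ENNReal.ofReal s ^ p) ^ k * coneMoment μ φ p (k * m) (backwardProd C *ᵥ x) := by
        gcongr
        exact coneMoment_mono hinv hφ hlx _ _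
      _ ≤ _ := pow_mul_coneMoment_backwardProd_le hK hinv hφ hs hC hq p (k * m) hx

/-- The moment after `k * m` factors is at most a constant times `‖E[A^{⊗p}]^(k * m)‖`; take `m`-th
roots and apply Gelfand's formula. -/
lemma le_realSpectralRadius_pow (hK : IsClosed K) (hinv : LeavesInvariant μ.support K)
    {φ : Fin n → ℝ} (hφ : ∀ x ∈ K, 0 ≤ φ ⬝ᵥ x) {s : ℝ} (hs : 0 ≤ s) {q : ℝ≥0∞} {k : ℕ}
    (hk : k ≠ 0) {C : Fin k → RMat n} (hC : ∀ i, C i ∈ coneMaps K)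
    (hq : ∀ i, q ≤ μ (dominating K s (C i))) {x : Fin n → ℝ} (hx : x ∈ K) (hφx : 0 < φ ⬝ᵥ x)
    {l : ℝ} (hl : 0 ≤ l) (hlx : backwardProd C *ᵥ x - l • x ∈ K) {p : ℕ}
    (hint : ∀ i j, Integrable (fun A => kroneckerPow A p i j) μ) :
    (q * ENNReal.ofReal s ^ p) ^ k * ENNReal.ofReal l ^ p ≤
      realSpectralRadius (expKroneckerPow μ p) ^ k := by
  set θ := (q * ENNReal.ofReal s ^ p) ^ k * ENNReal.ofReal l ^ p with hθ
  obtain ⟨c, hc0, hct, hc⟩ := exists_coneMoment_le hinv hφ hx hint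
  have hu0 : coneMoment μ φ p 0 x ≠ 0 := by
    rw [coneMoment_zero]
    exact pow_ne_zero _ (by simpa using hφx)
  have hut : coneMoment μ φ p 0 x ≠ ⊤ := by
    rw [coneMoment_zero]
    finiteness
  have h1 : Tendsto (fun m : ℕ => (c⁻¹ * coneMoment μ φ p 0 x * θ ^ m) ^ (1 / (m : ℝ))) atTop
      (𝓝 θ) := by
    refine ENNReal.tendsto_const_mul_rpow_one_div (mul_ne_zero (ENNReal.inv_ne_zero.2 hct) hu0)
      (ENNReal.mul_ne_top (ENNReal.inv_ne_top.2 hc0) hut) ?_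
    refine tendsto_const_nhds.congr' ?_
    filter_upwards [eventually_ne_atTop 0] with m hm
    rw [one_div, ENNReal.pow_rpow_inv_natCast hm]
  have h2 : Tendsto (fun m : ℕ => ‖complexExpKroneckerPow μ p ^ (k * m)‖ₑ ^ (1 / (m : ℝ))) atTop
      (𝓝 (realSpectralRadius (expKroneckerPow μ p) ^ k)) := by
    have hsub : Tendsto (fun m : ℕ => k * m) atTop atTop :=
      tendsto_id.const_mul_atTop' (Nat.pos_of_ne_zero hk)
    have := ((ENNReal.continuous_pow k).tendsto _).comp
      ((tendsto_enorm_complexExpKroneckerPow μ p).comp hsub)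
    refine this.congr fun m => ?_
    simp only [Function.comp_apply]
    rw [← ENNReal.rpow_natCast, ← ENNReal.rpow_mul]
    congr 1
    have : (k : ℝ) ≠ 0 := by exact_mod_cast hk
    push_cast
    field_simp
  refine le_of_tendsto_of_tendsto' h1 h2 fun m => ENNReal.rpow_le_rpow ?_ (by positivity)
  calc c⁻¹ * coneMoment μ φ p 0 x * θ ^ m = c⁻¹ * (θ ^ m * coneMoment μ φ p 0 x) := by ring
    _ ≤ c⁻¹ * (c * ‖complexExpKroneckerPow μ p ^ (k * m)‖ₑ) := by
      refine mul_le_mul_right ?_ c⁻¹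
      exact (pow_mul_coneMoment_zero_le hK hinv hφ hs hC hq hx hl hlx p m).trans (hc _)
    _ = _ := by rw [← mul_assoc, ENNReal.inv_mul_cancel hc0 hct, one_mul]

/-- The `K`-preserving matrices `C` such that, for each `s < 1`, the matrices that dominate `s • C`
have positive measure. -/
def chargedMaps (μ : Measure (RMat n)) (K : Set (Fin n → ℝ)) : Set (RMat n) :=
  {C | C ∈ coneMaps K ∧ ∀ s : ℝ, s < 1 → 0 < μ (dominating K s C)}

lemma ofReal_le_liminf_pow (hK : IsClosed K) (hinv : LeavesInvariant μ.support K)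
    {φ : Fin n → ℝ} (hφ : ∀ x ∈ K, 0 ≤ φ ⬝ᵥ x) {k : ℕ}
    (hk : k ≠ 0) {C : Fin k → RMat n} (hC : ∀ i, C i ∈ chargedMaps μ K)
    {x : Fin n → ℝ} (hx : x ∈ K) (hφx : 0 < φ ⬝ᵥ x)
    {l : ℝ} (hl : 0 ≤ l) (hlx : backwardProd C *ᵥ x - l • x ∈ K)
    (hint : ∀ p i j, Integrable (fun A => kroneckerPow A p i j) μ) :
    ENNReal.ofReal l ≤
      (liminf (fun p : ℕ => realSpectralRadius (expKroneckerPow μ p) ^ (1 / (p : ℝ))) atTop) ^ k := by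
  set r := fun p : ℕ => realSpectralRadius (expKroneckerPow μ p) ^ (1 / (p : ℝ)) with hr
  have key : ∀ s : ℝ, 0 < s → s < 1 → ENNReal.ofReal (s ^ k * l) ≤ (liminf r atTop) ^ k := by
    intro s hs0 hs1
    have : Nonempty (Fin k) := ⟨⟨0, Nat.pos_of_ne_zero hk⟩⟩
    obtain ⟨i₀, hi₀⟩ := Finite.exists_min fun i => μ (dominating K s (C i))
    -- `q` depends on `s` but not on `p`, so its contribution `(q ^ k) ^ (1 / p)` tends to `1`
    -- before `s → 1`.
    set q := μ (dominating K s (C i₀)) with hq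
    have hq0 : q ≠ 0 := ((hC i₀).2 s hs1).ne'
    have hqt : q ≠ ⊤ := measure_ne_top _ _
    have hmap : (liminf r atTop) ^ k = liminf (fun p => r p ^ k) atTop :=
      Monotone.map_liminf_of_continuousAt (f := fun t : ℝ≥0∞ => t ^ k)
        (fun a b hab => by dsimp only; gcongr) r (ENNReal.continuous_pow k).continuousAt
    rw [hmap]
    have hlim : Tendsto (fun p : ℕ => (q ^ k) ^ (1 / (p : ℝ)) * ENNReal.ofReal (s ^ k * l)) atTop
        (𝓝 (ENNReal.ofReal (s ^ k * l))) := by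
      have := ENNReal.Tendsto.mul_const (b := ENNReal.ofReal (s ^ k * l))
        (ENNReal.tendsto_const_rpow_one_div_nat (pow_ne_zero k hq0) (ENNReal.pow_ne_top hqt))
        (Or.inr ENNReal.ofReal_ne_top)
      rwa [one_mul] at this
    rw [← hlim.liminf_eq]
    refine liminf_le_liminf ?_
    filter_upwards [eventually_ne_atTop 0] with p hp
    have h := le_realSpectralRadius_pow hK hinv hφ hs0.le hk (fun i => (hC i).1) hi₀ hx hφx hl hlx
      (hint p)
    have h' := ENNReal.rpow_le_rpow h (z := 1 / (p : ℝ)) (by positivity)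
    have e1 : ((q * ENNReal.ofReal s ^ p) ^ k * ENNReal.ofReal l ^ p) =
        q ^ k * ENNReal.ofReal (s ^ k * l) ^ p := by
      rw [ENNReal.ofReal_mul (by positivity), ENNReal.ofReal_pow hs0.le]
      ring
    rw [e1, ENNReal.mul_rpow_of_nonneg _ _ (by positivity)] at h'
    nth_rewrite 2 [one_div] at h'
    rw [ENNReal.pow_rpow_inv_natCast hp] at h'
    refine h'.trans_eq ?_
    simp only [hr]
    rw [← ENNReal.rpow_natCast, ← ENNReal.rpow_natCast, ← ENNReal.rpow_mul, ← ENNReal.rpow_mul,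
      mul_comm]
  have hcont : Tendsto (fun s : ℝ => ENNReal.ofReal (s ^ k * l)) (𝓝[<] 1)
      (𝓝 (ENNReal.ofReal l)) := by
    have : Continuous fun s : ℝ => ENNReal.ofReal (s ^ k * l) :=
      ENNReal.continuous_ofReal.comp (by fun_prop)
    simpa using (this.tendsto 1).mono_left nhdsWithin_le_nhds
  refine le_of_tendsto hcont ?_
  filter_upwards [Ioo_mem_nhdsLT (zero_lt_one' ℝ)] with s hs
  exact key s hs.1 hs.2

lemma jointSpectralRadius_le_of_forall_enorm_le {M : Set (RMat n)} {L D : ℝ≥0∞} (hL : L ≠ ⊤)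
    (hD : D ≠ ⊤)
    (h : ∀ (k : ℕ) (A : Fin k → RMat n), (∀ i, A i ∈ M) → ‖backwardProd A‖ₑ ≤ D * L ^ (k + 1)) :
    jointSpectralRadius M ≤ L := by
  -- The surplus factor `L` goes into the constant, which the maximum keeps nonzero even if `L = 0`.
  set c := max (D * L) 1 with hc
  have hlim : Tendsto (fun k : ℕ => (c * L ^ k) ^ (1 / (k : ℝ))) atTop (𝓝 L) := by
    refine ENNReal.tendsto_const_mul_rpow_one_div (by positivity) (by simp [hc]; finiteness) ?_
    refine tendsto_const_nhds.congr' ?_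
    filter_upwards [eventually_ne_atTop 0] with m hm
    rw [one_div, ENNReal.pow_rpow_inv_natCast hm]
  rw [← hlim.limsup_eq]
  refine limsup_le_limsup (Eventually.of_forall fun k => iSup₂_le fun A hA => ?_)
  refine ENNReal.rpow_le_rpow ((h k A hA).trans ?_) (by positivity)
  rw [pow_succ', ← mul_assoc]
  gcongr
  exact le_max_left _ _

/-- The lower bound for the growth of the `p`-radii when some matrix in the support is interior to
the cone of `K`-preserving matrices. -/
lemma jointSpectralRadius_le_liminf_of_mem_interior (hK : IsSolidPointedCone K)
    (hinv : LeavesInvariant μ.support K)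
    (hint : ∀ p i j, Integrable (fun A => kroneckerPow A p i j) μ) {P : RMat n}
    (hP : P ∈ interior (coneMaps K)) (hPμ : P ∈ chargedMaps μ K)
    (hdense : μ.support ⊆ closure (chargedMaps μ K))
    (hfin : liminf (fun p : ℕ => realSpectralRadius (expKroneckerPow μ p) ^ (1 / (p : ℝ))) atTop
      ≠ ⊤) :
    jointSpectralRadius μ.support ≤
      liminf (fun p : ℕ => realSpectralRadius (expKroneckerPow μ p) ^ (1 / (p : ℝ))) atTop := by
  set L := liminf (fun p : ℕ => realSpectralRadius (expKroneckerPow μ p) ^ (1 / (p : ℝ))) atTop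
  obtain ⟨φ, c, hc, hφ⟩ := hK.exists_strictlyPositive
  have hφ0 : ∀ x ∈ K, 0 ≤ φ ⬝ᵥ x := fun x hx => le_trans (by positivity) (hφ x hx)
  obtain ⟨x, hx⟩ := hK.solid
  have hxK := interior_subset hx
  obtain ⟨C, hC, hCB⟩ := exists_norm_le_of_mem_coneMaps hc hφ hx
  obtain ⟨δ, hδ, hPδ⟩ := exists_rankOne_le_of_mem_interior hP x φ
  refine jointSpectralRadius_le_of_forall_enorm_le (D := ENNReal.ofReal (C / δ)) hfin
    ENNReal.ofReal_ne_top fun k A hA => ?_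
  have hBA := hCB _ (backwardProd_mem_coneMaps fun i => hinv _ (hA i))
  rcases (hφ0 x hxK).eq_or_lt with h0 | hpos
  -- Degenerate case, possible only for `n = 0`: every product has norm zero.
  · have hx0 : x = 0 := by
      have := hφ x hxK
      rw [← h0] at this
      exact norm_le_zero_iff.1 (nonpos_of_mul_nonpos_right this hc)
    rw [hx0] at hBA
    simp only [Matrix.mulVec_zero, dotProduct_zero, mul_zero, norm_le_zero_iff] at hBA
    simp [hBA]
  have hclosed : IsClosed {A : Fin k → RMat n |
      ENNReal.ofReal (δ * (φ ⬝ᵥ backwardProd A *ᵥ x)) ≤ L ^ (k + 1)} := by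
    refine isClosed_le (ENNReal.continuous_ofReal.comp (continuous_const.mul ?_)) continuous_const
    exact Continuous.dotProduct continuous_const
      (Continuous.matrix_mulVec (continuous_backwardProd k) continuous_const)
  have hsub : Set.pi Set.univ (fun _ : Fin k => chargedMaps μ K) ⊆ {A : Fin k → RMat n |
      ENNReal.ofReal (δ * (φ ⬝ᵥ backwardProd A *ᵥ x)) ≤ L ^ (k + 1)} := by
    intro A hA
    have hA' : ∀ i, A i ∈ chargedMaps μ K := fun i => hA i (Set.mem_univ i)
    have hBx : backwardProd A *ᵥ x ∈ K := backwardProd_mem_coneMaps (fun i => (hA' i).1) x hxK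
    -- Appending `P` as the last factor turns `B x` into a vector above `δ (φ ⬝ᵥ B x) • x`, hence
    -- the exponent `k + 1`.
    refine ofReal_le_liminf_pow (C := (Fin.snoc A P : Fin (k + 1) → RMat n)) hK.isClosed hinv hφ0
      (Nat.succ_ne_zero k) ?_ hxK hpos (mul_nonneg hδ.le (hφ0 _ hBx)) ?_ hint
    · intro i
      induction i using Fin.lastCases with
      | last => simpa using hPμ
      | cast i => simpa using hA' i
    · rw [backwardProd_snoc, ← Matrix.mulVec_mulVec]
      exact hPδ _ hBx
  have hmem : ENNReal.ofReal (δ * (φ ⬝ᵥ backwardProd A *ᵥ x)) ≤ L ^ (k + 1) := by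
    refine closure_minimal hsub hclosed ?_
    rw [closure_pi_set]
    exact fun i _ => hdense (hA i)
  calc ‖backwardProd A‖ₑ ≤ ENNReal.ofReal (C / δ * (δ * (φ ⬝ᵥ backwardProd A *ᵥ x))) := by
        rw [← ofReal_norm]
        refine ENNReal.ofReal_le_ofReal (hBA.trans_eq ?_)
        field_simp
    _ = ENNReal.ofReal (C / δ) * ENNReal.ofReal (δ * (φ ⬝ᵥ backwardProd A *ᵥ x)) :=
      ENNReal.ofReal_mul (by positivity)
    _ ≤ _ := by gcongr

end ConeMoment

/-! ### The lower bound for finitely many atoms -/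

section Atoms

variable {n : ℕ} {μ : Measure (RMat n)} [IsProbabilityMeasure μ]

/-- A single sequence of atoms has probability at least `c ^ k`, and its `1 / (p * k)`-th power `c ^
(1 / p)` does not depend on `k`. -/
lemma rpow_mul_iSup_le_pMean {c : ℝ≥0∞} (hc : ∀ A ∈ μ.support, c ≤ μ {A}) {p k : ℕ}
    (hp : p ≠ 0) (hk : k ≠ 0) :
    c ^ (1 / (p : ℝ)) * (⨆ (A : Fin k → RMat n) (_ : ∀ i, A i ∈ μ.support),
      ‖backwardProd A‖ₑ ^ (1 / (k : ℝ))) ≤ pMean μ p k := by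
  simp only [ENNReal.mul_iSup]
  refine iSup₂_le fun A hA => ?_
  have h1 : c ^ k * ‖backwardProd A‖ₑ ^ p ≤
      ∫⁻ A : Fin k → RMat n, ‖backwardProd A‖ₑ ^ p ∂(Measure.pi fun _ => μ) := by
    calc c ^ k * ‖backwardProd A‖ₑ ^ p
        ≤ (Measure.pi fun _ : Fin k => μ) {A} * ‖backwardProd A‖ₑ ^ p := by
          gcongr
          rw [Measure.pi_singleton]
          calc c ^ k = ∏ _i : Fin k, c := by simp
            _ ≤ _ := Finset.prod_le_prod' fun i _ => hc _ (hA i)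
      _ = ∫⁻ A in {A}, ‖backwardProd A‖ₑ ^ p ∂(Measure.pi fun _ : Fin k => μ) := by
        rw [lintegral_singleton, mul_comm]
      _ ≤ _ := setLIntegral_le_lintegral _ _
  refine le_trans (le_of_eq ?_) (ENNReal.rpow_le_rpow h1 (by positivity))
  have hp' : (p : ℝ) ≠ 0 := by exact_mod_cast hp
  have hk' : (k : ℝ) ≠ 0 := by exact_mod_cast hk
  rw [ENNReal.mul_rpow_of_nonneg _ _ (by positivity), ← ENNReal.rpow_natCast c,
    ← ENNReal.rpow_natCast ‖backwardProd A‖ₑ, ← ENNReal.rpow_mul, ← ENNReal.rpow_mul]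
  congr 2 <;> field_simp

/-- The lower bound for the growth of the `p`-radii of a measure with finitely many atoms as its
support. -/
lemma jointSpectralRadius_le_liminf_of_atoms {c : ℝ≥0∞} (hc0 : c ≠ 0) (hct : c ≠ ⊤)
    (hc : ∀ A ∈ μ.support, c ≤ μ {A}) (hfin : jointSpectralRadius μ.support ≠ ⊤) {r : ℕ → ℝ≥0∞}
    (hr : ∀ p, 1 ≤ p → Tendsto (pMean μ p) atTop (𝓝 (r p))) :
    jointSpectralRadius μ.support ≤ liminf r atTop := by
  have hlim : Tendsto (fun p : ℕ => c ^ (1 / (p : ℝ)) * jointSpectralRadius μ.support) atTop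
      (𝓝 (jointSpectralRadius μ.support)) := by
    have := ENNReal.Tendsto.mul_const (b := jointSpectralRadius μ.support)
      (ENNReal.tendsto_const_rpow_one_div_nat hc0 hct) (Or.inr hfin)
    rwa [one_mul] at this
  conv_lhs => rw [← hlim.liminf_eq]
  refine liminf_le_liminf ?_
  filter_upwards [eventually_ge_atTop 1] with p hp
  rw [← (hr p hp).limsup_eq, jointSpectralRadius,
    ← ENNReal.limsup_const_mul_of_ne_top (ENNReal.rpow_ne_top_of_nonneg (by positivity) hct)]
  refine limsup_le_limsup ?_
  filter_upwards [eventually_ne_atTop 0] with k hk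
  exact rpow_mul_iSup_le_pMean hc (by omega) hk

end Atoms

/-! ### Consequences of the form of the singular part -/

section LebesgueDecomposition

variable {n : ℕ}

instance lebesgueRMat.instIsAddHaarMeasure (n : ℕ) : (lebesgueRMat n).IsAddHaarMeasure :=
  Measure.pi.isAddHaarMeasure fun _ : Fin n => (volume : Measure (Fin n → ℝ))

instance lebesgueRMat.instSigmaFinite (n : ℕ) : SigmaFinite (lebesgueRMat n) :=
  inferInstanceAs (SigmaFinite (volume : Measure (Fin n → Fin n → ℝ)))

/-- A measure absolutely continuous with respect to Lebesgue measure and dominated by `μ`, charges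
the part of `supp μ` that is interior to the cone of `K`-preserving matrices. -/
lemma exists_mem_interior_coneMaps {K : Set (Fin n → ℝ)} (hK : Convex ℝ K)
    {μ ν : Measure (RMat n)} [SigmaFinite μ] (hinv : LeavesInvariant μ.support K) (hνμ : ν ≤ μ)
    (hν : ν ≪ lebesgueRMat n) {U : Set (RMat n)} (hU : ν U ≠ 0) :
    ∃ C ∈ U, C ∈ μ.support ∧ C ∈ interior (coneMaps K) := by
  by_contra! h
  -- Otherwise `U` is covered by the complement of the support, null since `ν ≤ μ`, and the frontier
  -- of a convex set, which is Lebesgue-null.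
  refine hU (measure_mono_null (t := μ.supportᶜ ∪ frontier (coneMaps K)) ?_
    (measure_union_null ?_ (hν ((convex_coneMaps hK).addHaar_frontier _))))
  · intro C hC
    by_cases hCμ : C ∈ μ.support
    · exact Or.inr ⟨subset_closure (hinv C hCμ), h C hC hCμ⟩
    · exact Or.inl hCμ
  · exact le_antisymm ((hνμ _).trans_eq Measure.measure_compl_support) zero_le

end LebesgueDecomposition

section Support

variable {n : ℕ} {K : Set (Fin n → ℝ)} {μ : Measure (RMat n)}

lemma mem_chargedMaps_of_mem_interior (hK : IsSolidPointedCone K) {C : RMat n}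
    (hC : C ∈ interior (coneMaps K)) (hCμ : C ∈ μ.support) : C ∈ chargedMaps μ K :=
  ⟨interior_subset hC, fun _ hs =>
    (Measure.mem_support_iff_forall _).1 hCμ _ (hK.eventually_sub_smul_mem hC hs)⟩

lemma mem_chargedMaps_of_singleton_pos (hK : IsSolidPointedCone K) {C : RMat n}
    (hC : C ∈ coneMaps K) (hCμ : 0 < μ {C}) : C ∈ chargedMaps μ K := by
  refine ⟨hC, fun s hs => hCμ.trans_le (measure_mono ?_)⟩
  rw [Set.singleton_subset_iff]
  change C - s • C ∈ coneMaps K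
  rw [show C - s • C = (1 - s) • C by module]
  exact hK.smul_mem_coneMaps (by linarith) hC

/-- If the singular part is a finite sum of Dirac measures, then either every point of the support
is an atom, or some point of the support is interior to the cone of `K`-preserving matrices. -/
lemma support_dichotomy [IsProbabilityMeasure μ] (hK : IsSolidPointedCone K)
    (hinv : LeavesInvariant μ.support K) (hsing : SingularPartIsFiniteDiracSum μ) :
    (∃ c : ℝ≥0∞, c ≠ 0 ∧ c ≠ ⊤ ∧ ∀ A ∈ μ.support, c ≤ μ {A}) ∨
      ((∃ P ∈ interior (coneMaps K), P ∈ chargedMaps μ K) ∧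
        μ.support ⊆ closure (chargedMaps μ K)) := by
  obtain ⟨N, c, M, hc, hM⟩ := hsing
  set ν := lebesgueRMat n with hν
  set μa := ν.withDensity (μ.rnDeriv ν) with hμa
  have hdec : μ = μ.singularPart ν + μa := μ.haveLebesgueDecomposition_add ν
  have hle : μa ≤ μ := Measure.withDensity_rnDeriv_le μ ν
  have hac : μa ≪ ν := withDensity_absolutelyContinuous _ _
  have hfin : (Set.range M).Finite := Set.finite_range M
  have hFm : MeasurableSet (Set.range M) := hfin.measurableSet
  have hs0 : μ.singularPart ν (Set.range M)ᶜ = 0 := by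
    rw [hM, Measure.finsetSum_apply]
    refine Finset.sum_eq_zero fun i _ => ?_
    rw [Measure.smul_apply, Measure.dirac_apply' _ hFm.compl]
    simp
  have hatom : ∀ A ∈ Set.range M, 0 < μ {A} := by
    rintro _ ⟨i, rfl⟩
    have h1 : (0 : ℝ≥0∞) < (ENNReal.ofReal (c i) • Measure.dirac (M i)) {M i} := by
      simpa using hc i
    refine h1.trans_le (le_trans ?_ (Measure.singularPart_le μ ν {M i}))
    rw [hM, Measure.finsetSum_apply]
    exact Finset.single_le_sum (f := fun j => (ENNReal.ofReal (c j) • Measure.dirac (M j)) {M i})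
      (fun _ _ => zero_le) (Finset.mem_univ i)
  -- Removing the finitely many atoms of the singular part from a neighbourhood leaves positive
  -- mass, all of it absolutely continuous.
  have hnear : ∀ A ∈ μ.support, A ∉ Set.range M → ∀ U ∈ 𝓝 A, μa U ≠ 0 := by
    intro A hA hAM U hU h0
    have hpos := (Measure.mem_support_iff_forall _).1 hA _
      (inter_mem hU (hfin.isClosed.isOpen_compl.mem_nhds hAM))
    rw [hdec, Measure.add_apply, measure_mono_null Set.inter_subset_right hs0,
      measure_mono_null Set.inter_subset_left h0, add_zero] at hpos
    exact lt_irrefl _ hpos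
  by_cases ha : μa Set.univ = 0
  · left
    have hsub : μ.support ⊆ Set.range M := fun A hA => by
      by_contra hAM
      exact hnear A hA hAM _ univ_mem ha
    obtain ⟨A₀, hA₀, hmin⟩ := Set.exists_min_image μ.support (fun A => μ {A}) (hfin.subset hsub)
      (Measure.nonempty_support (IsProbabilityMeasure.ne_zero μ))
    exact ⟨μ {A₀}, (hatom _ (hsub hA₀)).ne', measure_ne_top _ _, hmin⟩
  · right
    constructor
    · obtain ⟨P, -, hPμ, hP⟩ := exists_mem_interior_coneMaps hK.convex hinv hle hac ha
      exact ⟨P, hP, mem_chargedMaps_of_mem_interior hK hP hPμ⟩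
    · intro A hA
      by_cases hAM : A ∈ Set.range M
      · exact subset_closure (mem_chargedMaps_of_singleton_pos hK (hinv A hA) (hatom A hAM))
      · refine mem_closure_iff_nhds.2 fun U hU => ?_
        obtain ⟨C, hCU, hCμ, hC⟩ := exists_mem_interior_coneMaps hK.convex hinv hle hac
          (hnear A hA hAM U hU)
        exact ⟨C, hCU, mem_chargedMaps_of_mem_interior hK hC hCμ⟩

end Support

/-! ### Conclusion -/

theorem mainTheorem1 (n : ℕ) (μ : Measure (RMat n)) [IsProbabilityMeasure μ]
    (hbdd : Bornology.IsBounded μ.support)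
    (hcone : LeavesProperConeInvariant μ.support)
    (hsing : SingularPartIsFiniteDiracSum μ) :
    -- the quantities involved are well defined and finite
    jointSpectralRadius μ.support ≠ ⊤ ∧
    (∀ p : ℕ, 1 ≤ p → Tendsto (pMean μ p) atTop (𝓝 (pRadius μ p)) ∧ pRadius μ p ≠ ⊤) ∧
    (∀ p : ℕ, 1 ≤ p → ∀ i j, Integrable (fun A => kroneckerPow A p i j) μ) ∧
    -- the two limit formulas
    Tendsto (fun p : ℕ => pRadius μ p) atTop (𝓝 (jointSpectralRadius μ.support)) ∧
    Tendsto (fun p : ℕ => realSpectralRadius (expKroneckerPow μ p) ^ (1 / (p : ℝ))) atTop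
      (𝓝 (jointSpectralRadius μ.support)) := by
  have hint : ∀ p i j, Integrable (fun A => kroneckerPow A p i j) μ :=
    fun p i j => integrable_kroneckerPow hbdd p i j
  have hlim : ∀ p, Tendsto (pMean μ p) atTop
      (𝓝 (realSpectralRadius (expKroneckerPow μ p) ^ (1 / (p : ℝ)))) := fun p =>
    tendsto_pMean_of_leavesProperConeInvariant hcone (hint p)
  have hrad : ∀ p, pRadius μ p = realSpectralRadius (expKroneckerPow μ p) ^ (1 / (p : ℝ)) :=
    fun p => (hlim p).limUnder_eq
  have hfin : jointSpectralRadius μ.support ≠ ⊤ := jointSpectralRadius_ne_top hbdd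
  have hupper : ∀ p, 1 ≤ p → realSpectralRadius (expKroneckerPow μ p) ^ (1 / (p : ℝ)) ≤
      jointSpectralRadius μ.support := fun p hp => le_jointSpectralRadius_of_tendsto_pMean hp (hlim p)
  have hlimsup : limsup (fun p : ℕ => realSpectralRadius (expKroneckerPow μ p) ^ (1 / (p : ℝ)))
      atTop ≤ jointSpectralRadius μ.support :=
    limsup_le_of_le (by isBoundedDefault) ((eventually_ge_atTop 1).mono hupper)
  have hliminf : jointSpectralRadius μ.support ≤
      liminf (fun p : ℕ => realSpectralRadius (expKroneckerPow μ p) ^ (1 / (p : ℝ))) atTop := by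
    obtain ⟨K, hK, hinv⟩ := hcone
    rcases support_dichotomy hK hinv hsing with ⟨c, hc0, hct, hc⟩ | ⟨⟨P, hP, hPμ⟩, hdense⟩
    · exact jointSpectralRadius_le_liminf_of_atoms hc0 hct hc hfin fun p _ => hlim p
    · exact jointSpectralRadius_le_liminf_of_mem_interior hK hinv hint hP hPμ hdense
        (ne_top_of_le_ne_top hfin (le_trans liminf_le_limsup hlimsup))
  have hmain := tendsto_of_le_liminf_of_limsup_le hliminf hlimsup
  refine ⟨hfin, fun p hp => ?_, fun p _ => hint p, hmain.congr fun p => (hrad p).symm, hmain⟩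
  rw [hrad p]
  exact ⟨hlim p, ne_top_of_le_ne_top hfin (hupper p hp)⟩
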